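/- **Theorem (almost sure convergence of the momentum-adjusted double Q-learning rule).** Let $\mathcal S,\mathcal A$ be finite sets and consider a Markov decision process on them in which taking action $a$ in state $s$ produces a random pair (reward, next state) in $\mathbb R\times\mathcal S$ with law $P_{s,a}$. Let $r(s,a)$ denote the reward under $P_{s,a}$, suppose $\operatorname{Var}[r(s,a)]<\infty$ for all $(s,a)$, let $0\le\gamma<1$, and let $$Q^*(s,a)=\sup_\pi \mathbb E_\pi\Big[\sum_{n\ge 0}\gamma^n r_n\,\Big|\,s_0=s,\ a_0=a\Big]$$ be the optimal value function, the supremum being over stationary randomized policies $\pi$. On a probability space with a filtration $(\mathcal F_t)_{t\ge0}$, let $(s_t,a_t)$ be $\mathcal F_t$-measurable state-action pairs, let $(r_t,s'_t)$ be $\mathcal F_{t+1}$-measurable rewards and next states whose conditional law given $\mathcal F_t$ is $P_{s_t,a_t}$ (for example along a trajectory, $s_{t+1}=s'_t$), and let the learning rates $\alpha_t(s,a)$ be $\mathcal F_t$-measurable. Let $Q_0,Q'_0:\mathcal S\times\mathcal A\to\mathbb R$ be arbitrary $\mathcal F_0$-measurable tables. For each $t\ge 0$ let $a'_t$ be an $\mathcal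 F_{t+1}$-measurable choice of action in $\arg\max_{b}Q_t(s'_t,b)$, and put $$\delta_t=|Q_t(s'_t,a'_t)-Q'_t(s'_t,a'_t)|,\qquad \delta_{-1}=0,$$ $$y_t=r_t+\gamma\Big(\max\{Q_t(s'_t,a'_t),Q'_t(s'_t,a'_t)\}-\tfrac12(\delta_t+\delta_{t-1})\Big).$$ Both tables are updated with this target at the sampled pair, $$Q_{t+1}(s_t,a_t)=(1-\alpha_t(s_t,a_t))\,Q_t(s_t,a_t)+\alpha_t(s_t,a_t)\,y_t,$$ $$Q'_{t+1}(s_t,a_t)=(1-\alpha_t(s_t,a_t))\,Q'_t(s_t,a_t)+\alpha_t(s_t,a_t)\,y_t,$$ and all other entries are left unchanged. Suppose that, with probability $1$, every pair $(s,a)$ is sampled infinitely often (so both $Q$ and $Q'$ receive infinitely many updates at every pair), $0<\alpha_t(s_t,a_t)<1$ for all $t$, and for every pair $(s,a)$ $$\sum_{t:\,(s_t,a_t)=(s,a)}\alpha_t(s,a)=\infty,\qquad \sum_{t:\,(s_t,a_t)=(s,a)}\alpha_t(s,a)^2<\infty .$$ Then, with probability $1$, $Q_t(s,a)\to Q^*(s,a)$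 and $Q'_t(s,a)\to Q^*(s,a)$ for every $(s,a)\in\mathcal S\times\mathcal A$. -/

import Mathlib

open MeasureTheory ProbabilityTheory Filter Topology

noncomputable section

/-- A Markov decision process with state space `S` and action space `A`: taking action `a` in
state `s` produces a random pair (reward, next state) with law `law s a`. -/
structure MDP (S A : Type*) [MeasurableSpace S] where
  law : S → A → Measure (ℝ × S)
  isProbabilityMeasure_law : ∀ s a, IsProbabilityMeasure (law s a)

namespace MDP

variable {S A : Type*} [MeasurableSpace S]

/-- The transition probability `p(s' | s, a)`. -/
def trans (M : MDP S A) (s : S) (a : A) (s' : S) : ℝ :=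
  (M.law s a).real (Prod.snd ⁻¹' {s'})

/-- The expected reward `E[r(s, a)]`. -/
def meanReward (M : MDP S A) (s : S) (a : A) : ℝ :=
  ∫ z, z.1 ∂(M.law s a)

/-- `Var[r(s, a)]`, as an extended nonnegative real (it is `⊤` when the reward is not
square-integrable). -/
def rewardVariance (M : MDP S A) (s : S) (a : A) : ENNReal :=
  evariance (fun z : ℝ × S => z.1) (M.law s a)

open Classical in
/-- `M.pairProb π s a n x b` is the probability that `(s_n, a_n) = (x, b)` when
`(s_0, a_0) = (s, a)` and every later action is drawn from the (randomized, stationary)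
policy `π`, where `π x` is a probability vector on the actions. -/
def pairProb [Fintype S] [Fintype A] (M : MDP S A) (π : S → stdSimplex ℝ A) (s : S) (a : A) :
    ℕ → S → A → ℝ
  | 0 => fun x b => if x = s ∧ b = a then 1 else 0
  | n + 1 => fun x b => (∑ y : S, ∑ c : A, M.pairProb π s a n y c * M.trans y c x) * (π x).1 b

/-- The action-value function of the policy `π`: the expected discounted return
`∑ₙ γⁿ E[r_n | s_0 = s, a_0 = a]`. -/
def qValue [Fintype S] [Fintype A] (M : MDP S A) (γ : ℝ) (π : S → stdSimplex ℝ A)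
    (s : S) (a : A) : ℝ :=
  ∑' n : ℕ, γ ^ n * ∑ x : S, ∑ b : A, M.pairProb π s a n x b * M.meanReward x b

/-- The optimal value function `Q*(s, a) = sup_π Q^π(s, a)`. -/
def qStar [Fintype S] [Fintype A] (M : MDP S A) (γ : ℝ) (s : S) (a : A) : ℝ :=
  ⨆ π : S → stdSimplex ℝ A, M.qValue γ π s a

/-- The process `(s t, a t, r t, s' t)` samples transitions of `M` relative to the filtration
`ℱ`: the pair `(s t, a t)` is known at time `t`, the reward `r t` and the next state `s' t` are
known at time `t + 1`, and the conditional law of `(r t, s' t)` given `ℱ t` is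
`M.law (s t) (a t)`. It is allowed, but not required, that `s (t + 1) = s' t`. -/
structure IsSampling [MeasurableSpace A] (M : MDP S A) {Ω : Type*} [mΩ : MeasurableSpace Ω]
    (μ : Measure Ω) (ℱ : Filtration ℕ mΩ) (s : ℕ → Ω → S) (a : ℕ → Ω → A)
    (r : ℕ → Ω → ℝ) (s' : ℕ → Ω → S) : Prop where
  measurable_state : ∀ t, Measurable[ℱ t] (s t)
  measurable_action : ∀ t, Measurable[ℱ t] (a t)
  measurable_reward : ∀ t, Measurable[ℱ (t + 1)] (r t)
  measurable_next : ∀ t, Measurable[ℱ (t + 1)] (s' t)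
  condLaw : ∀ t, ∀ B : Set (ℝ × S), MeasurableSet B →
    μ[((fun ω => (r t ω, s' t ω)) ⁻¹' B).indicator (fun _ => (1 : ℝ)) | ℱ t]
      =ᵐ[μ] fun ω => (M.law (s t ω) (a t ω)).real B

end MDP

section Momentum

variable {S A : Type*}

/-- The difference `|Q(s', a') - Q'(s', a')|` of two tables. -/
def tableGap (q q' : S → A → ℝ) (x : S) (b : A) : ℝ := |q x b - q' x b|

/-- The momentum target `r + γ (max(Q(s', a'), Q'(s', a')) - Δ_adj)`, where
`Δ_adj = (|Q(s', a') - Q'(s', a')| + Δ_last) / 2`. -/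
def momentumTarget (γ r : ℝ) (q q' : S → A → ℝ) (x : S) (b : A) (last : ℝ) : ℝ :=
  r + γ * (max (q x b) (q' x b) - (tableGap q q' x b + last) / 2)

open Classical in
/-- Replace the entry `(s, a)` of the table `q` by `(1 - α) q(s, a) + α y`. -/
def tableUpdate (q : S → A → ℝ) (s : S) (a : A) (α y : ℝ) : S → A → ℝ :=
  fun x b => if x = s ∧ b = a then (1 - α) * q x b + α * y else q x b

/-- `Δ_last` at time `t`: it is `0` at the start, and afterwards the difference
`|Q - Q'|` that was computed at the previous step, at the previous next state `s' (t - 1)` and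
the action `a' (t - 1)` chosen there. -/
def lastGap (Q Q' : ℕ → S → A → ℝ) (s' : ℕ → S) (a' : ℕ → A) : ℕ → ℝ
  | 0 => 0
  | t + 1 => tableGap (Q t) (Q' t) (s' t) (a' t)

/-- The tables `Q t`, `Q' t` are produced by the momentum-adjusted double Q-learning rule from
the transitions `(s t, a t, r t, s' t)` and the learning rates `α t`. The action `a' t` at the
next state is greedy for `Q t` (ties are broken arbitrarily), and both tables are moved towards
the same momentum target at the entry `(s t, a t)`. -/
structure IsMomentumDoubleQ (γ : ℝ) (s : ℕ → S) (a : ℕ → A) (r : ℕ → ℝ) (s' : ℕ → S)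
    (a' : ℕ → A) (α : ℕ → S → A → ℝ) (Q Q' : ℕ → S → A → ℝ) : Prop where
  greedy : ∀ t b, Q t (s' t) b ≤ Q t (s' t) (a' t)
  update_fst : ∀ t, Q (t + 1) = tableUpdate (Q t) (s t) (a t) (α t (s t) (a t))
    (momentumTarget γ (r t) (Q t) (Q' t) (s' t) (a' t) (lastGap Q Q' s' a' t))
  update_snd : ∀ t, Q' (t + 1) = tableUpdate (Q' t) (s t) (a t) (α t (s t) (a t))
    (momentumTarget γ (r t) (Q t) (Q' t) (s' t) (a' t) (lastGap Q Q' s' a' t))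

open Classical in
/-- The learning rate with which the entry `(x, b)` is updated at time `t`: it is `α t x b` if
`(x, b)` is the sampled pair `(s t, a t)`, and `0` otherwise. -/
def effectiveRate (s : ℕ → S) (a : ℕ → A) (α : ℕ → S → A → ℝ) (x : S) (b : A) (t : ℕ) : ℝ :=
  if s t = x ∧ a t = b then α t x b else 0

end Momentum

end

/-!
Both tables are moved towards the same target at the same entry, so their difference `Q - Q'` is
multiplied by `1 - α` at each update and tends to zero along every path on which the learning rates
have infinite sum (`IsMomentumDoubleQ.tendsto_sub_zero`). Hence all momentum corrections vanish,
and the target is that of ordinary `Q`-learning, `r + γ max_b Q(s', b)`, up to a null sequence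
(`IsMomentumDoubleQ.exists_tendsto_zero_abs_target_sub_le`). It remains to show that perturbed
asynchronous `Q`-learning converges to the fixed point of the Bellman operator, and that this fixed
point is `Q*`.

The probabilistic input is that martingale differences with bounded conditional variance, weighted
by predictable square-summable weights, have an almost surely convergent sum
(`ae_exists_tendsto_sum_mul`), and that such noise disappears from a running average
(`tendsto_runningAverage_zero`). It is used twice. The centered rewards have bounded conditional
variance whatever the tables do. Once their running average is subtracted, the rest of the target
is pathwise at most `γ` times the sup norm of the table plus a constant, so the tables are bounded
along almost every path (`IsMomentumDoubleQ.exists_abs_le`). The transition noise is the sum over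
`y` of `max_b Q_t(y, b)` times the centered indicator of `s'_t = y`. Here the indicator is the
martingale difference, and the value is absorbed into the predictable weight, which is
square-summable because the table is bounded. After subtracting the running average of the total
noise and the fixed point `q`, what is left satisfies an asynchronous `γ`-contraction with
vanishing perturbation, and so tends to zero (`tendsto_zero_of_async_contraction`).

For the identification of `q`, let `f_n` be the expectation of `q` over the `n`-th state-action
pair under a policy. The expected reward of step `n` is at most `f_n - γ f_{n+1}`, with equality for
a greedy policy, and the discounted sum of these differences telescopes to the initial value of
`q`. So `q` is the supremum of the values of all policies (`MDP.qStar_eq_of_bellman_eq`).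
-/

/-! ### Averaging recursions on the real line -/

/-- A sequence that is pulled towards values at most `c` with nonsummable weights is eventually
below every `c' > c`. -/
theorem eventually_le_of_averaging {z β : ℕ → ℝ} {c c' : ℝ}
    (hβ1 : ∀ n, β n ≤ 1)
    (hβ : Tendsto (fun n => ∑ t ∈ Finset.range n, β t) atTop atTop)
    (hz : ∀ᶠ n in atTop, z (n + 1) ≤ (1 - β n) * z n + β n * c) (hc : c < c') :
    ∀ᶠ n in atTop, z n ≤ c' := by
  obtain ⟨N, hN⟩ := eventually_atTop.1 hz
  set S : ℕ → ℝ := fun n => ∑ t ∈ Finset.range n, β t with hS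
  -- the excess over `c` decays at least like the product of the factors `1 - β ≤ exp (-β)`
  have key : ∀ n, N ≤ n → z n - c ≤ Real.exp (S N - S n) * max (z N - c) 0 := by
    intro n hn
    induction n, hn using Nat.le_induction with
    | base => simp
    | succ n hn ih =>
      have h1 : 1 - β n ≤ Real.exp (-β n) := by
        have := Real.add_one_le_exp (-β n); linarith
      have h2 : S N - S (n + 1) = (-β n) + (S N - S n) := by
        simp only [hS, Finset.sum_range_succ]; ring
      have h3 : 0 ≤ Real.exp (S N - S n) * max (z N - c) 0 := by positivity
      calc z (n + 1) - c ≤ (1 - β n) * (z n - c) := by linarith [hN n hn]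
        _ ≤ (1 - β n) * (Real.exp (S N - S n) * max (z N - c) 0) :=
            mul_le_mul_of_nonneg_left ih (by linarith [hβ1 n])
        _ ≤ Real.exp (-β n) * (Real.exp (S N - S n) * max (z N - c) 0) :=
            mul_le_mul_of_nonneg_right h1 h3
        _ = _ := by rw [h2, Real.exp_add, mul_assoc]
  have hlim : Tendsto (fun n => Real.exp (S N - S n) * max (z N - c) 0) atTop (𝓝 0) := by
    have : Tendsto (fun n => S N - S n) atTop atBot :=
      tendsto_atBot_add_const_left _ (S N) (tendsto_neg_atTop_atBot.comp hβ)
    simpa using (Real.tendsto_exp_atBot.comp this).mul_const (max (z N - c) 0)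
  filter_upwards [hlim.eventually (gt_mem_nhds (sub_pos.2 hc)), eventually_ge_atTop N]
    with n h1 h2
  linarith [key n h2]

theorem tendsto_zero_of_averaging {z β c : ℕ → ℝ}
    (hβ0 : ∀ n, 0 ≤ β n) (hβ1 : ∀ n, β n ≤ 1)
    (hβ : Tendsto (fun n => ∑ t ∈ Finset.range n, β t) atTop atTop)
    (hc : Tendsto c atTop (𝓝 0)) (hz : ∀ n, z (n + 1) = (1 - β n) * z n + β n * c n) :
    Tendsto z atTop (𝓝 0) := by
  rw [Metric.tendsto_nhds]
  intro ε hε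
  have h := eventually_le_of_averaging (z := fun n => |z n|) (c := ε / 3) (c' := ε / 2)
    hβ1 hβ ?_ (by linarith)
  · filter_upwards [h] with n hn
    rw [Real.dist_eq, sub_zero]; linarith
  · filter_upwards [(Metric.tendsto_nhds.1 hc) (ε / 3) (by linarith)] with n hn
    rw [Real.dist_eq, sub_zero] at hn
    have h0 := hβ0 n
    have h1 := sub_nonneg.2 (hβ1 n)
    calc |z (n + 1)| ≤ |(1 - β n) * z n| + |β n * c n| := by rw [hz]; exact abs_add_le _ _
      _ = (1 - β n) * |z n| + β n * |c n| := by
        rw [abs_mul, abs_mul, abs_of_nonneg h0, abs_of_nonneg h1]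
      _ ≤ _ := by gcongr

/-- The running average that starts at `0` and moves towards `ξ t` with weight `β t`. -/
def runningAverage (β ξ : ℕ → ℝ) : ℕ → ℝ
  | 0 => 0
  | t + 1 => (1 - β t) * runningAverage β ξ t + β t * ξ t

/-- If the weighted noise is summable (conditionally), then its running average vanishes in the
limit. -/
theorem tendsto_runningAverage_zero {β ξ : ℕ → ℝ} {l : ℝ}
    (hβ0 : ∀ n, 0 ≤ β n) (hβ1 : ∀ n, β n ≤ 1)
    (hβ : Tendsto (fun n => ∑ t ∈ Finset.range n, β t) atTop atTop)
    (hl : Tendsto (fun n => ∑ t ∈ Finset.range n, β t * ξ t) atTop (𝓝 l)) :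
    Tendsto (runningAverage β ξ) atTop (𝓝 0) := by
  set S : ℕ → ℝ := fun n => ∑ t ∈ Finset.range n, β t * ξ t with hS
  have h0 : Tendsto (fun n => S n - l) atTop (𝓝 0) := by simpa using hl.sub_const l
  -- subtracting the tail of the noise series leaves an averaging recursion with vanishing input
  have h1 : Tendsto (fun n => runningAverage β ξ n - (S n - l)) atTop (𝓝 0) := by
    refine tendsto_zero_of_averaging (c := fun n => -(S n - l)) hβ0 hβ1 hβ
      (by simpa using h0.neg) fun n => ?_
    simp only [runningAverage, hS, Finset.sum_range_succ]
    ring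
  simpa using h1.add h0

/-! ### Asynchronous contractions -/

section Contraction

variable {ι : Type*} {γ : ℝ} {Z β : ℕ → ι → ℝ} {c : ℕ → ℝ}

/-- An asynchronous recursion whose input is at most `γ` times the current sup norm plus a
bounded term stays bounded. The hypothesis quantifies over upper bounds `D` of the current sup
norm. -/
theorem bounded_of_async_contraction [Finite ι] (hγ1 : γ < 1)
    (hβ0 : ∀ n i, 0 ≤ β n i) (hβ1 : ∀ n i, β n i ≤ 1)
    (hZ : ∀ n D, (∀ i, |Z n i| ≤ D) → ∀ i,
      |Z (n + 1) i| ≤ (1 - β n i) * |Z n i| + β n i * (γ * D + c n))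
    {C : ℝ} (hc : ∀ n, c n ≤ C) : ∃ B, ∀ n i, |Z n i| ≤ B := by
  obtain ⟨B₀, hB₀⟩ := (Set.finite_range fun i => |Z 0 i|).bddAbove
  -- a bound `B` is preserved as soon as `γ * B + C ≤ B`
  refine ⟨max B₀ (C / (1 - γ)), fun n => ?_⟩
  set B := max B₀ (C / (1 - γ)) with hB
  have hCB : γ * B + C ≤ B := by
    have := (div_le_iff₀ (sub_pos.2 hγ1)).1 (le_max_right B₀ (C / (1 - γ)))
    rw [← hB] at this
    linarith
  induction n with
  | zero => exact fun i => (hB₀ ⟨i, rfl⟩).trans (le_max_left _ _)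
  | succ n ih =>
    intro i
    have h1 := sub_nonneg.2 (hβ1 n i)
    calc |Z (n + 1) i| ≤ (1 - β n i) * |Z n i| + β n i * (γ * B + c n) := hZ n B ih i
      _ ≤ (1 - β n i) * B + β n i * B :=
          add_le_add (mul_le_mul_of_nonneg_left (ih i) h1)
            (mul_le_mul_of_nonneg_left (by linarith [hc n]) (hβ0 n i))
      _ = B := by ring

/-- An asynchronous recursion whose input is at most `γ` times the current sup norm plus a
vanishing term tends to zero, provided that every coordinate receives infinite total weight. -/
theorem tendsto_zero_of_async_contraction [Finite ι] (hγ0 : 0 ≤ γ) (hγ1 : γ < 1)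
    (hβ0 : ∀ n i, 0 ≤ β n i) (hβ1 : ∀ n i, β n i ≤ 1)
    (hβ : ∀ i, Tendsto (fun n => ∑ t ∈ Finset.range n, β t i) atTop atTop)
    (hZ : ∀ n D, (∀ i, |Z n i| ≤ D) → ∀ i,
      |Z (n + 1) i| ≤ (1 - β n i) * |Z n i| + β n i * (γ * D + c n))
    (hc : Tendsto c atTop (𝓝 0)) (i : ι) : Tendsto (fun n => Z n i) atTop (𝓝 0) := by
  obtain ⟨C, hC⟩ := hc.bddAbove_range
  obtain ⟨B, hB⟩ := bounded_of_async_contraction hγ1 hβ0 hβ1 hZ fun n => hC ⟨n, rfl⟩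
  -- every round of averaging shrinks the eventual bound by the factor `γ`, up to `ε`
  have key : ∀ ε > 0, ∀ k : ℕ, ∀ᶠ n in atTop, ∀ i, |Z n i| ≤ γ ^ k * B + ε := by
    intro ε hε k
    have hε' : 0 < (1 - γ) * ε := mul_pos (sub_pos.2 hγ1) hε
    induction k with
    | zero => exact Eventually.of_forall fun n i => by linarith [hB n i]
    | succ k ih =>
      refine eventually_all.2 fun i => ?_
      refine eventually_le_of_averaging (β := fun n => β n i)
        (c := γ * (γ ^ k * B + ε) + (1 - γ) * ε / 2) (fun n => hβ1 n i) (hβ i) ?_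
        (by rw [pow_succ]; linarith)
      filter_upwards [ih, hc.eventually (gt_mem_nhds (half_pos hε'))] with n h1 h2
      refine (hZ n _ h1 i).trans ?_
      have := mul_le_mul_of_nonneg_left h2.le (hβ0 n i)
      linarith
  rw [Metric.tendsto_nhds]
  intro ε hε
  have hk : Tendsto (fun k : ℕ => γ ^ k * B) atTop (𝓝 0) := by
    simpa using (tendsto_pow_atTop_nhds_zero_of_lt_one hγ0 hγ1).mul_const B
  obtain ⟨k, hk⟩ := (hk.eventually (gt_mem_nhds (half_pos hε))).exists
  filter_upwards [key (ε / 2) (half_pos hε) k] with n hn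
  rw [Real.dist_eq, sub_zero]
  linarith [hn i]

end Contraction

/-! ### The Bellman optimality equation -/

/-- The greedy value `max_b q(x, b)` of the state `x`, for a table `q` on finitely many actions. -/
noncomputable def greedyValue {S A : Type*} (q : S → A → ℝ) (x : S) : ℝ := ⨆ b, q x b

section GreedyValue

variable {S A : Type*} [Finite A]

theorem le_greedyValue (q : S → A → ℝ) (x : S) (b : A) : q x b ≤ greedyValue q x :=
  le_ciSup (Set.finite_range fun b => q x b).bddAbove b

theorem greedyValue_eq_of_forall_le {q : S → A → ℝ} {x : S} {b : A} (h : ∀ c, q x c ≤ q x b) :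
    greedyValue q x = q x b :=
  have : Nonempty A := ⟨b⟩
  le_antisymm (ciSup_le h) (le_greedyValue q x b)

theorem abs_greedyValue_sub_le [Nonempty A] {q q' : S → A → ℝ} {x : S} {D : ℝ}
    (h : ∀ b, |q x b - q' x b| ≤ D) : |greedyValue q x - greedyValue q' x| ≤ D := by
  rw [abs_le]
  constructor
  · have : greedyValue q' x ≤ greedyValue q x + D := ciSup_le fun b => by
      have := abs_le.1 (h b); have := le_greedyValue q x b; linarith
    linarith
  · have : greedyValue q x ≤ greedyValue q' x + D := ciSup_le fun b => by
      have := abs_le.1 (h b); have := le_greedyValue q' x b; linarith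
    linarith

theorem abs_greedyValue_le [Nonempty A] {q : S → A → ℝ} {x : S} {D : ℝ}
    (h : ∀ b, |q x b| ≤ D) : |greedyValue q x| ≤ D := by
  have h0 : greedyValue (fun (_ : S) (_ : A) => (0 : ℝ)) x = 0 := ciSup_const
  simpa [h0] using abs_greedyValue_sub_le (q := q) (q' := fun _ _ => 0) (x := x) (D := D)
    (by simpa using h)

end GreedyValue

theorem exists_abs_le_of_finite {X Y : Type*} [Finite X] [Finite Y] (f : X → Y → ℝ) :
    ∃ D, ∀ x y, |f x y| ≤ D := by
  obtain ⟨D, hD⟩ := (Set.finite_range fun p : X × Y => |f p.1 p.2|).bddAbove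
  exact ⟨D, fun x y => hD ⟨(x, y), rfl⟩⟩

namespace MDP

variable {S A : Type*} [MeasurableSpace S]

theorem trans_nonneg (M : MDP S A) (x : S) (b : A) (y : S) : 0 ≤ M.trans x b y :=
  measureReal_nonneg

variable [Fintype S]

theorem sum_trans [MeasurableSingletonClass S] (M : MDP S A) (x : S) (b : A) :
    ∑ y, M.trans x b y = 1 := by
  have := M.isProbabilityMeasure_law x b
  unfold trans
  rw [← measureReal_biUnion_finset (fun i _ j _ hij => by
      simpa [Function.onFun] using Disjoint.preimage _ (Set.disjoint_singleton.2 hij))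
    (fun i _ => measurable_snd (measurableSet_singleton i)),
    ← Set.preimage_iUnion₂]
  simp [Set.iUnion_of_singleton]

theorem abs_sum_trans_mul_le [MeasurableSingletonClass S] (M : MDP S A) (x : S) (b : A)
    {v : S → ℝ} {D : ℝ} (h : ∀ y, |v y| ≤ D) : |∑ y, M.trans x b y * v y| ≤ D :=
  calc |∑ y, M.trans x b y * v y| ≤ ∑ y, |M.trans x b y * v y| := Finset.abs_sum_le_sum_abs _ _
    _ ≤ ∑ y, M.trans x b y * D := Finset.sum_le_sum fun y _ => by
        rw [abs_mul, abs_of_nonneg (M.trans_nonneg x b y)]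
        exact mul_le_mul_of_nonneg_left (h y) (M.trans_nonneg x b y)
    _ = D := by rw [← Finset.sum_mul, M.sum_trans, one_mul]

/-- The Bellman optimality operator
`(T q)(x, b) = E[r(x, b)] + γ ∑_y p(y | x, b) max_c q(y, c)`. -/
noncomputable def bellman (M : MDP S A) (γ : ℝ) (q : S → A → ℝ) : S → A → ℝ :=
  fun x b => M.meanReward x b + γ * ∑ y, M.trans x b y * greedyValue q y

section

variable [Fintype A]

theorem pairProb_nonneg (M : MDP S A) (π : S → stdSimplex ℝ A) (s : S) (a : A) (n : ℕ)
    (x : S) (b : A) : 0 ≤ M.pairProb π s a n x b := by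
  induction n generalizing x b with
  | zero => simp only [pairProb]; split_ifs <;> norm_num
  | succ n ih =>
    exact mul_nonneg (Finset.sum_nonneg fun y _ => Finset.sum_nonneg fun c _ =>
      mul_nonneg (ih y c) (M.trans_nonneg y c x)) ((π x).2.1 b)

theorem sum_pairProb_zero (M : MDP S A) (π : S → stdSimplex ℝ A) (s : S) (a : A)
    (f : S → A → ℝ) : ∑ x, ∑ b, M.pairProb π s a 0 x b * f x b = f s a := by
  rw [Finset.sum_eq_single s, Finset.sum_eq_single a] <;> simp +contextual [pairProb]

/-- One step of the chain of state-action pairs, tested against a function `f`. -/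
theorem sum_pairProb_succ (M : MDP S A) (π : S → stdSimplex ℝ A) (s : S) (a : A) (n : ℕ)
    (f : S → A → ℝ) :
    ∑ x, ∑ b, M.pairProb π s a (n + 1) x b * f x b
      = ∑ y, ∑ c, M.pairProb π s a n y c *
          ∑ x, M.trans y c x * ∑ b, (π x).1 b * f x b := by
  have h1 : ∀ x, ∑ b, M.pairProb π s a (n + 1) x b * f x b
      = ∑ y, ∑ c, M.pairProb π s a n y c * (M.trans y c x * ∑ b, (π x).1 b * f x b) := by
    intro x
    simp only [pairProb, mul_assoc, ← Finset.mul_sum]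
    simp only [Finset.sum_mul, mul_assoc]
  simp only [h1, Finset.mul_sum (s := Finset.univ (α := S))]
  rw [Finset.sum_comm]
  exact Finset.sum_congr rfl fun y _ => Finset.sum_comm

variable [MeasurableSingletonClass S]

theorem abs_bellman_sub_le [Nonempty A] (M : MDP S A) {γ : ℝ} (hγ0 : 0 ≤ γ) {q q' : S → A → ℝ}
    {D : ℝ} (h : ∀ x b, |q x b - q' x b| ≤ D) (x : S) (b : A) :
    |M.bellman γ q x b - M.bellman γ q' x b| ≤ γ * D := by
  have : M.bellman γ q x b - M.bellman γ q' x b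
      = γ * ∑ y, M.trans x b y * (greedyValue q y - greedyValue q' y) := by
    simp only [bellman, mul_sub, Finset.sum_sub_distrib]; ring
  rw [this, abs_mul, abs_of_nonneg hγ0]
  exact mul_le_mul_of_nonneg_left
    (M.abs_sum_trans_mul_le x b fun y => abs_greedyValue_sub_le (h y)) hγ0

theorem exists_bellman_eq_self [Nonempty A] (M : MDP S A) {γ : ℝ} (hγ0 : 0 ≤ γ) (hγ1 : γ < 1) :
    ∃ q : S → A → ℝ, M.bellman γ q = q := by
  have : ContractingWith ⟨γ, hγ0⟩ (M.bellman γ) := by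
    refine ⟨by exact_mod_cast hγ1, LipschitzWith.of_dist_le_mul fun q q' => ?_⟩
    have h0 : 0 ≤ γ * dist q q' := mul_nonneg hγ0 dist_nonneg
    refine (dist_pi_le_iff h0).2 fun x => (dist_pi_le_iff h0).2 fun b => ?_
    exact M.abs_bellman_sub_le hγ0
      (fun x b => (dist_le_pi_dist (q x) (q' x) b).trans (dist_le_pi_dist q q' x)) x b
  exact ⟨_, this.fixedPoint_isFixedPt⟩

theorem sum_pairProb (M : MDP S A) (π : S → stdSimplex ℝ A) (s : S) (a : A) (n : ℕ) :
    ∑ x, ∑ b, M.pairProb π s a n x b = 1 := by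
  induction n with
  | zero => simpa using M.sum_pairProb_zero π s a fun _ _ => 1
  | succ n ih =>
    have h := M.sum_pairProb_succ π s a n fun _ _ => 1
    have hπ : ∀ x, ∑ b, (π x).1 b = 1 := fun x => (π x).2.2
    simpa [hπ, M.sum_trans, ih] using h

theorem abs_sum_pairProb_mul_le (M : MDP S A) (π : S → stdSimplex ℝ A) (s : S) (a : A) (n : ℕ)
    {f : S → A → ℝ} {D : ℝ} (h : ∀ x b, |f x b| ≤ D) :
    |∑ x, ∑ b, M.pairProb π s a n x b * f x b| ≤ D :=
  calc |∑ x, ∑ b, M.pairProb π s a n x b * f x b|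
      ≤ ∑ x, ∑ b, |M.pairProb π s a n x b * f x b| :=
        (Finset.abs_sum_le_sum_abs _ _).trans
          (Finset.sum_le_sum fun x _ => Finset.abs_sum_le_sum_abs _ _)
    _ ≤ ∑ x, ∑ b, M.pairProb π s a n x b * D := by
        refine Finset.sum_le_sum fun x _ => Finset.sum_le_sum fun b _ => ?_
        rw [abs_mul, abs_of_nonneg (M.pairProb_nonneg π s a n x b)]
        exact mul_le_mul_of_nonneg_left (h x b) (M.pairProb_nonneg π s a n x b)
    _ = D := by simp only [← Finset.sum_mul, M.sum_pairProb, one_mul]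

theorem summable_qValue (M : MDP S A) {γ : ℝ} (hγ0 : 0 ≤ γ) (hγ1 : γ < 1)
    (π : S → stdSimplex ℝ A) (s : S) (a : A) (f : S → A → ℝ) :
    Summable fun n : ℕ => γ ^ n * ∑ x, ∑ b, M.pairProb π s a n x b * f x b := by
  obtain ⟨D, hD⟩ := exists_abs_le_of_finite f
  refine Summable.of_norm_bounded ((summable_geometric_of_lt_one hγ0 hγ1).mul_right D)
    fun n => ?_
  rw [norm_mul, Real.norm_eq_abs, Real.norm_eq_abs, abs_of_nonneg (pow_nonneg hγ0 n)]
  exact mul_le_mul_of_nonneg_left (M.abs_sum_pairProb_mul_le π s a n hD) (pow_nonneg hγ0 n)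

/-- The discounted sums of `f_n - γ f_{n+1}`, where `f_n` is the expectation of a table `q` after
`n` steps, telescope to the initial value of `q`. -/
theorem hasSum_telescope (M : MDP S A) {γ : ℝ} (hγ0 : 0 ≤ γ) (hγ1 : γ < 1)
    (π : S → stdSimplex ℝ A) (s : S) (a : A) (q : S → A → ℝ) :
    HasSum (fun n : ℕ => γ ^ n * (∑ x, ∑ b, M.pairProb π s a n x b * q x b
      - γ * ∑ x, ∑ b, M.pairProb π s a (n + 1) x b * q x b)) (q s a) := by
  have hs := M.summable_qValue hγ0 hγ1 π s a q
  have h := hs.hasSum.sub ((summable_nat_add_iff 1).2 hs).hasSum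
  rw [hs.tsum_eq_zero_add, add_sub_cancel_right, pow_zero, one_mul, M.sum_pairProb_zero] at h
  simp only [mul_sub, ← mul_assoc, ← pow_succ]
  exact h

/-- The value of a policy is at most the fixed point of the Bellman operator, since the expected
reward of every step is at most `f_n - γ f_{n+1}`. -/
theorem qValue_le_of_bellman_eq (M : MDP S A) {γ : ℝ} (hγ0 : 0 ≤ γ) (hγ1 : γ < 1)
    {q : S → A → ℝ} (hq : M.bellman γ q = q) (π : S → stdSimplex ℝ A) (s : S) (a : A) :
    M.qValue γ π s a ≤ q s a := by
  refine hasSum_le (fun n => ?_) (M.summable_qValue hγ0 hγ1 π s a M.meanReward).hasSum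
    (M.hasSum_telescope hγ0 hγ1 π s a q)
  refine mul_le_mul_of_nonneg_left ?_ (pow_nonneg hγ0 n)
  rw [M.sum_pairProb_succ, Finset.mul_sum, ← Finset.sum_sub_distrib]
  refine Finset.sum_le_sum fun x _ => ?_
  rw [Finset.mul_sum, ← Finset.sum_sub_distrib]
  refine Finset.sum_le_sum fun b _ => ?_
  have h1 : q x b = M.meanReward x b + γ * ∑ y, M.trans x b y * greedyValue q y :=
    (congrFun (congrFun hq x) b).symm
  have h2 : ∑ y, M.trans x b y * ∑ c, (π y).1 c * q y c
      ≤ ∑ y, M.trans x b y * greedyValue q y := by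
    refine Finset.sum_le_sum fun y _ => mul_le_mul_of_nonneg_left ?_ (M.trans_nonneg x b y)
    calc ∑ c, (π y).1 c * q y c ≤ ∑ c, (π y).1 c * greedyValue q y :=
          Finset.sum_le_sum fun c _ =>
            mul_le_mul_of_nonneg_left (le_greedyValue q y c) ((π y).2.1 c)
      _ = greedyValue q y := by rw [← Finset.sum_mul, (π y).2.2, one_mul]
  have h3 := mul_le_mul_of_nonneg_left h2 hγ0
  have h4 := mul_le_mul_of_nonneg_left (show M.meanReward x b ≤ q x b
    - γ * ∑ y, M.trans x b y * ∑ c, (π y).1 c * q y c by linarith) (M.pairProb_nonneg π s a n x b)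
  linarith

theorem exists_qValue_eq_of_bellman_eq [Nonempty A] (M : MDP S A) {γ : ℝ} (hγ0 : 0 ≤ γ)
    (hγ1 : γ < 1) {q : S → A → ℝ} (hq : M.bellman γ q = q) :
    ∃ π : S → stdSimplex ℝ A, ∀ s a, M.qValue γ π s a = q s a := by
  classical
  choose g hg using fun x => Finite.exists_max (q x)
  -- the deterministic policy that is greedy for `q`
  obtain ⟨π, hπ⟩ : ∃ π : S → stdSimplex ℝ A,
      ∀ y, ∑ c, (π y).1 c * q y c = greedyValue q y := by
    refine ⟨fun x => ⟨Pi.single (g x) 1, single_mem_stdSimplex ℝ (g x)⟩, fun y => ?_⟩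
    rw [greedyValue_eq_of_forall_le (hg y)]
    simp [Pi.single_apply]
  refine ⟨π, fun s a => HasSum.tsum_eq ?_⟩
  convert M.hasSum_telescope hγ0 hγ1 π s a q using 3 with n
  rw [M.sum_pairProb_succ, Finset.mul_sum, ← Finset.sum_sub_distrib]
  refine Finset.sum_congr rfl fun x _ => ?_
  rw [Finset.mul_sum, ← Finset.sum_sub_distrib]
  refine Finset.sum_congr rfl fun b _ => ?_
  have h1 : q x b = M.meanReward x b + γ * ∑ y, M.trans x b y * greedyValue q y :=
    (congrFun (congrFun hq x) b).symm
  simp only [hπ]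
  rw [h1]; ring

theorem qStar_eq_of_bellman_eq [Nonempty A] (M : MDP S A) {γ : ℝ} (hγ0 : 0 ≤ γ) (hγ1 : γ < 1)
    {q : S → A → ℝ} (hq : M.bellman γ q = q) : M.qStar γ = q := by
  obtain ⟨π, hπ⟩ := M.exists_qValue_eq_of_bellman_eq hγ0 hγ1 hq
  funext s a
  have hle := fun π => M.qValue_le_of_bellman_eq hγ0 hγ1 hq π s a
  have : Nonempty (S → stdSimplex ℝ A) := ⟨π⟩
  exact le_antisymm (ciSup_le hle)
    ((hπ s a).symm.le.trans (le_ciSup ⟨q s a, Set.forall_mem_range.2 hle⟩ π))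

theorem bellman_qStar [Nonempty A] (M : MDP S A) {γ : ℝ} (hγ0 : 0 ≤ γ) (hγ1 : γ < 1) :
    M.bellman γ (M.qStar γ) = M.qStar γ := by
  obtain ⟨q, hq⟩ := M.exists_bellman_eq_self hγ0 hγ1
  rw [M.qStar_eq_of_bellman_eq hγ0 hγ1 hq, hq]

end

end MDP

/-! ### Weighted sums of martingale differences -/

section Martingale

variable {Ω : Type*} [mΩ : MeasurableSpace Ω] {μ : Measure Ω} [IsProbabilityMeasure μ]
  {ℱ : Filtration ℕ mΩ} {b ξ : ℕ → Ω → ℝ} {C K : ℝ}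

/-- Martingale differences `ξ` with bounded conditional variance, weighted by predictable `b` with
uniformly bounded `∑ b²`, have an almost surely convergent sum: the partial sums form an
`L²`-bounded martingale. -/
theorem ae_exists_tendsto_sum_mul_of_sum_sq_le (hC : 0 ≤ C)
    (hb : ∀ t, Measurable[ℱ t] (b t)) (hξm : ∀ t, Measurable[ℱ (t + 1)] (ξ t))
    (hξ2 : ∀ t, MemLp (ξ t) 2 μ) (hξ0 : ∀ t, μ[ξ t | ℱ t] =ᵐ[μ] 0)
    (hξC : ∀ t, μ[fun ω => ξ t ω ^ 2 | ℱ t] ≤ᵐ[μ] fun _ => C)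
    (hK : ∀ n ω, ∑ t ∈ Finset.range n, b t ω ^ 2 ≤ K) :
    ∀ᵐ ω ∂μ, ∃ l, Tendsto (fun n => ∑ t ∈ Finset.range n, b t ω * ξ t ω) atTop (𝓝 l) := by
  have hbK : ∀ t ω, b t ω ^ 2 ≤ K := fun t ω =>
    (Finset.single_le_sum (f := fun t => b t ω ^ 2) (fun _ _ => sq_nonneg _)
      (Finset.mem_range.2 t.lt_succ_self)).trans (hK (t + 1) ω)
  have hbK' : ∀ t ω, ‖b t ω‖ ≤ √K := fun t ω => Real.abs_le_sqrt (hbK t ω)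
  have hb' : ∀ t, StronglyMeasurable[ℱ t] (b t) := fun t => (hb t).stronglyMeasurable
  have hbm : ∀ t, Measurable (b t) := fun t => (hb t).mono (ℱ.le t) le_rfl
  have hξm' : ∀ t, Measurable (ξ t) := fun t => (hξm t).mono (ℱ.le _) le_rfl
  set g : ℕ → Ω → ℝ := fun t => b t * ξ t with hg
  set M : ℕ → Ω → ℝ := fun n ω => ∑ t ∈ Finset.range n, b t ω * ξ t ω with hM
  have hg2 : ∀ t, MemLp (g t) 2 μ := fun t =>
    (hξ2 t).of_le_mul (c := √K) ((hbm t).mul (hξm' t)).aestronglyMeasurable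
      (ae_of_all _ fun ω => by
        simp only [hg, Pi.mul_apply, norm_mul]
        exact mul_le_mul_of_nonneg_right (hbK' t ω) (norm_nonneg _))
  have hM2 : ∀ n, MemLp (M n) 2 μ := fun n =>
    memLp_finsetSum (f := g) (Finset.range n) fun t _ => hg2 t
  have hMsucc : ∀ n, M (n + 1) = M n + g n := fun n => by
    funext ω; simp [hM, hg, Finset.sum_range_succ]
  have hMm : ∀ n, StronglyMeasurable[ℱ n] (M n) := fun n => by
    refine (Finset.measurable_sum _ fun t ht => ?_).stronglyMeasurable
    have ht := Finset.mem_range.1 ht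
    exact ((hb t).mono (ℱ.mono ht.le) le_rfl).mul
      ((hξm t).mono (ℱ.mono (Nat.succ_le_of_lt ht)) le_rfl)
  have hg0 : ∀ t, μ[g t | ℱ t] =ᵐ[μ] 0 := fun t => by
    filter_upwards [condExp_stronglyMeasurable_mul_of_bound (ℱ.le t) (hb' t)
      ((hξ2 t).integrable one_le_two) _ (ae_of_all μ (hbK' t)), hξ0 t] with ω h1 h2
    simp only [hg, h1, Pi.mul_apply, h2, Pi.zero_apply, mul_zero]
  have hmart : Martingale M ℱ μ := by
    refine martingale_nat hMm (fun n => (hM2 n).integrable one_le_two) fun n => ?_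
    have h := condExp_add ((hM2 n).integrable one_le_two) ((hg2 n).integrable one_le_two) (ℱ n)
    rw [condExp_of_stronglyMeasurable (ℱ.le n) (hMm n) ((hM2 n).integrable one_le_two)] at h
    rw [hMsucc]
    filter_upwards [h, hg0 n] with ω h1 h2
    simp [h1, h2]
  -- the increments are orthogonal to the past
  have hcross : ∀ n, ∫ ω, M n ω * g n ω ∂μ = 0 := fun n => by
    have h := condExp_mul_of_stronglyMeasurable_left (hMm n) ((hM2 n).integrable_mul (hg2 n))
      ((hg2 n).integrable one_le_two)
    have h0 : μ[M n * g n | ℱ n] =ᵐ[μ] 0 := by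
      filter_upwards [h, hg0 n] with ω h1 h2
      simp [h1, h2]
    calc ∫ ω, M n ω * g n ω ∂μ = ∫ ω, (μ[M n * g n | ℱ n]) ω ∂μ := (integral_condExp (ℱ.le n)).symm
      _ = 0 := by rw [integral_congr_ae h0]; simp
  have hbint : ∀ t, Integrable (fun ω => b t ω ^ 2) μ := fun t =>
    Integrable.of_bound ((hbm t).pow_const 2).aestronglyMeasurable K
      (ae_of_all _ fun ω => by rw [Real.norm_eq_abs, abs_of_nonneg (sq_nonneg _)]; exact hbK t ω)
  have hsq : ∀ t, ∫ ω, g t ω ^ 2 ∂μ ≤ C * ∫ ω, b t ω ^ 2 ∂μ := fun t => by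
    have h := condExp_stronglyMeasurable_mul_of_bound (ℱ.le t) ((hb' t).pow 2)
      (hξ2 t).integrable_sq K (ae_of_all μ fun ω => by
        rw [Pi.pow_apply, Real.norm_eq_abs, abs_of_nonneg (sq_nonneg _)]; exact hbK t ω)
    have hfun : (fun ω => g t ω ^ 2) = (b t ^ 2 * fun ω => ξ t ω ^ 2) := by
      funext ω; simp [hg, mul_pow]
    rw [← integral_const_mul, hfun, ← integral_condExp (ℱ.le t)]
    refine integral_mono_ae integrable_condExp ((hbint t).const_mul C) ?_
    filter_upwards [h, hξC t] with ω h1 h2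
    rw [h1, Pi.mul_apply, Pi.pow_apply, mul_comm]
    exact mul_le_mul_of_nonneg_right h2 (sq_nonneg _)
  have hM2le : ∀ n, ∫ ω, M n ω ^ 2 ∂μ ≤ C * ∑ t ∈ Finset.range n, ∫ ω, b t ω ^ 2 ∂μ := by
    intro n
    induction n with
    | zero => simp [hM]
    | succ n ih =>
      have h1 : ∫ ω, M (n + 1) ω ^ 2 ∂μ
          = ∫ ω, M n ω ^ 2 ∂μ + 2 * ∫ ω, M n ω * g n ω ∂μ + ∫ ω, g n ω ^ 2 ∂μ := by
        have hMg : Integrable (fun ω => M n ω * g n ω) μ := (hM2 n).integrable_mul (hg2 n)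
        have hMg' : Integrable (fun ω => M n ω ^ 2 + 2 * (M n ω * g n ω)) μ :=
          (hM2 n).integrable_sq.add (hMg.const_mul 2)
        rw [← integral_const_mul, ← integral_add (hM2 n).integrable_sq (hMg.const_mul 2),
          ← integral_add hMg' (hg2 n).integrable_sq]
        refine integral_congr_ae (ae_of_all _ fun ω => ?_)
        simp only [hMsucc, Pi.add_apply]
        ring
      rw [h1, hcross, Finset.sum_range_succ, mul_add]
      linarith [hsq n]
  have hbound : ∀ n, eLpNorm (M n) 1 μ ≤ (Real.toNNReal (1 + C * K) : ENNReal) := fun n => by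
    rw [eLpNorm_one_eq_lintegral_enorm,
      ← ofReal_integral_norm_eq_lintegral_enorm ((hM2 n).integrable one_le_two)]
    refine ENNReal.ofReal_le_ofReal ?_
    calc ∫ ω, ‖M n ω‖ ∂μ ≤ ∫ ω, (1 + M n ω ^ 2) ∂μ := by
          refine integral_mono ((hM2 n).integrable one_le_two).norm
            ((integrable_const 1).add (hM2 n).integrable_sq) fun ω => ?_
          simp only [Real.norm_eq_abs]
          nlinarith [sq_nonneg (|M n ω| - 1), sq_abs (M n ω), abs_nonneg (M n ω)]
      _ = 1 + ∫ ω, M n ω ^ 2 ∂μ := by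
          rw [integral_add (integrable_const 1) (hM2 n).integrable_sq]; simp
      _ ≤ 1 + C * ∑ t ∈ Finset.range n, ∫ ω, b t ω ^ 2 ∂μ := by linarith [hM2le n]
      _ ≤ 1 + C * K := by
          rw [← integral_finsetSum _ fun t _ => hbint t]
          have : ∫ ω, ∑ t ∈ Finset.range n, b t ω ^ 2 ∂μ ≤ ∫ _, K ∂μ :=
            integral_mono (integrable_finsetSum _ fun t _ => hbint t) (integrable_const K) (hK n)
          rw [integral_const, probReal_univ, one_smul] at this
          linarith [mul_le_mul_of_nonneg_left this hC]
  exact hmart.submartingale.exists_ae_tendsto_of_bdd hbound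

/-- Martingale differences `ξ` with bounded conditional variance, weighted by predictable `b` with
`∑ b² < ∞` almost surely, have an almost surely convergent sum. -/
theorem ae_exists_tendsto_sum_mul (hC : 0 ≤ C)
    (hb : ∀ t, Measurable[ℱ t] (b t)) (hξm : ∀ t, Measurable[ℱ (t + 1)] (ξ t))
    (hξ2 : ∀ t, MemLp (ξ t) 2 μ) (hξ0 : ∀ t, μ[ξ t | ℱ t] =ᵐ[μ] 0)
    (hξC : ∀ t, μ[fun ω => ξ t ω ^ 2 | ℱ t] ≤ᵐ[μ] fun _ => C)
    (hsum : ∀ᵐ ω ∂μ, Summable fun t => b t ω ^ 2) :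
    ∀ᵐ ω ∂μ, ∃ l, Tendsto (fun n => ∑ t ∈ Finset.range n, b t ω * ξ t ω) atTop (𝓝 l) := by
  classical
  -- the weights `b`, switched off once `∑ b²` exceeds `K`
  let c : ℕ → ℕ → Ω → ℝ := fun K t ω =>
    if ∑ k ∈ Finset.range (t + 1), b k ω ^ 2 ≤ K then b t ω else 0
  have hc : ∀ K t, Measurable[ℱ t] (c K t) := fun K t => by
    refine Measurable.ite (measurableSet_le (Finset.measurable_sum _ fun k hk => ?_)
      measurable_const) (hb t) measurable_const
    exact ((hb k).mono (ℱ.mono (Nat.lt_succ_iff.1 (Finset.mem_range.1 hk))) le_rfl).pow_const 2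
  have hcK : ∀ (K : ℕ) n ω, ∑ t ∈ Finset.range n, c K t ω ^ 2 ≤ K := by
    intro K n ω
    induction n with
    | zero => simp
    | succ n ih =>
      by_cases h : ∑ k ∈ Finset.range (n + 1), b k ω ^ 2 ≤ K
      · refine (Finset.sum_le_sum fun t _ => ?_).trans h
        simp only [c]
        split_ifs
        · exact le_rfl
        · rw [zero_pow two_ne_zero]; exact sq_nonneg _
      · rw [Finset.sum_range_succ]
        simpa [c, h] using ih
  have hall := ae_all_iff.2 fun K : ℕ =>
    ae_exists_tendsto_sum_mul_of_sum_sq_le hC (hc K) hξm hξ2 hξ0 hξC (hcK K)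
  filter_upwards [hall, hsum] with ω h hs
  obtain ⟨K, hK⟩ := exists_nat_ge (∑' t, b t ω ^ 2)
  have hcb : ∀ t, c K t ω = b t ω := fun t =>
    if_pos ((hs.sum_le_tsum _ fun _ _ => sq_nonneg _).trans hK)
  simpa only [hcb] using h K

end Martingale

/-! ### The conditional law of the sampled transitions -/

theorem Measurable.eval_of_countable {X Y Ω : Type*} [Countable X] [MeasurableSpace X]
    [MeasurableSingletonClass X] [MeasurableSpace Y] {m : MeasurableSpace Ω} {f : X → Ω → Y}
    {g : Ω → X} (hf : ∀ x, Measurable (f x)) (hg : Measurable g) :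
    Measurable fun ω => f (g ω) ω :=
  (measurable_from_prod_countable_right (f := fun p : X × Ω => f p.1 p.2) hf).comp
    (hg.prodMk measurable_id)

namespace MDP.IsSampling

variable {S A : Type*} [MeasurableSpace S] [MeasurableSpace A] {M : MDP S A}
  {Ω : Type*} [mΩ : MeasurableSpace Ω] {μ : Measure Ω}
  {ℱ : Filtration ℕ mΩ} {s : ℕ → Ω → S} {a : ℕ → Ω → A} {r : ℕ → Ω → ℝ} {s' : ℕ → Ω → S}

theorem measurable_sample (h : M.IsSampling μ ℱ s a r s') (t : ℕ) :
    Measurable[ℱ (t + 1)] fun ω => (r t ω, s' t ω) :=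
  (h.measurable_reward t).prodMk (h.measurable_next t)

theorem map_restrict_eq [IsProbabilityMeasure μ] (h : M.IsSampling μ ℱ s a r s') {t : ℕ} {x : S} {b : A} {G : Set Ω}
    (hG : MeasurableSet[ℱ t] G) (hGxb : ∀ ω ∈ G, s t ω = x ∧ a t ω = b) :
    (μ.restrict G).map (fun ω => (r t ω, s' t ω)) = μ G • M.law x b := by
  have := M.isProbabilityMeasure_law x b
  have hY : Measurable fun ω => (r t ω, s' t ω) := (h.measurable_sample t).mono (ℱ.le _) le_rfl
  ext B hB
  have hGm := ℱ.le t _ hG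
  have key : μ.real ((fun ω => (r t ω, s' t ω)) ⁻¹' B ∩ G) = μ.real G * (M.law x b).real B := by
    have hint : Integrable (((fun ω => (r t ω, s' t ω)) ⁻¹' B).indicator fun _ => (1 : ℝ)) μ :=
      (integrable_const 1).indicator (hY hB)
    have h1 := setIntegral_condExp (ℱ.le t) hint hG
    rw [setIntegral_congr_ae hGm ((h.condLaw t B hB).mono fun ω hω _ => hω),
      setIntegral_congr_fun hGm (g := fun _ => (M.law x b).real B)
        (fun ω hω => by simp only [(hGxb ω hω).1, (hGxb ω hω).2]),
      setIntegral_const, integral_indicator (hY hB), setIntegral_const, smul_eq_mul, smul_eq_mul,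
      mul_one, measureReal_restrict_apply (hY hB)] at h1
    exact h1.symm
  rw [Measure.map_apply hY hB, Measure.restrict_apply (hY hB), Measure.smul_apply, smul_eq_mul]
  rw [← ENNReal.toReal_eq_toReal_iff' (measure_ne_top _ _)
    (ENNReal.mul_ne_top (measure_ne_top _ _) (measure_ne_top _ _)), ENNReal.toReal_mul]
  exact key

variable [MeasurableSingletonClass S] [MeasurableSingletonClass A]

theorem measurableSet_pair (h : M.IsSampling μ ℱ s a r s') (t : ℕ) (x : S) (b : A) :
    MeasurableSet[ℱ t] {ω | s t ω = x ∧ a t ω = b} :=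
  (h.measurable_state t (measurableSet_singleton x)).inter
    (h.measurable_action t (measurableSet_singleton b))

variable [Fintype S] [Fintype A] [IsProbabilityMeasure μ] {f : S → A → ℝ × S → ℝ}

theorem integrable_sample (h : M.IsSampling μ ℱ s a r s')
    (hf : ∀ x b, Integrable (f x b) (M.law x b)) (t : ℕ) :
    Integrable (fun ω => f (s t ω) (a t ω) (r t ω, s' t ω)) μ := by
  have hY : Measurable fun ω => (r t ω, s' t ω) := (h.measurable_sample t).mono (ℱ.le _) le_rfl
  have hcov : ⋃ p : S × A, {ω | s t ω = p.1 ∧ a t ω = p.2} = Set.univ :=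
    Set.eq_univ_of_forall fun ω => Set.mem_iUnion.2 ⟨(s t ω, a t ω), rfl, rfl⟩
  rw [← integrableOn_univ, ← hcov, integrableOn_finite_iUnion]
  rintro ⟨x, b⟩
  have hG := h.measurableSet_pair t x b
  have hint : Integrable (f x b)
      ((μ.restrict {ω | s t ω = x ∧ a t ω = b}).map fun ω => (r t ω, s' t ω)) := by
    rw [h.map_restrict_eq hG fun ω hω => hω]
    exact (hf x b).smul_measure (measure_ne_top _ _)
  exact IntegrableOn.congr_fun (hint.comp_measurable hY)
    (fun ω hω => by simp only [hω.1, hω.2, Function.comp_apply]) (ℱ.le t _ hG)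

/-- The conditional expectation given `ℱ t` of a function of the sampled transition is its
expectation under the law of the current state-action pair. -/
theorem condExp_sample (h : M.IsSampling μ ℱ s a r s')
    (hf : ∀ x b, Integrable (f x b) (M.law x b)) (t : ℕ) :
    μ[fun ω => f (s t ω) (a t ω) (r t ω, s' t ω) | ℱ t]
      =ᵐ[μ] fun ω => ∫ z, f (s t ω) (a t ω) z ∂(M.law (s t ω) (a t ω)) := by
  have hY : Measurable fun ω => (r t ω, s' t ω) := (h.measurable_sample t).mono (ℱ.le _) le_rfl
  have hint := h.integrable_sample hf t
  have hm : Measurable[ℱ t] fun ω => ∫ z, f (s t ω) (a t ω) z ∂(M.law (s t ω) (a t ω)) :=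
    (measurable_of_countable fun p : S × A => ∫ z, f p.1 p.2 z ∂(M.law p.1 p.2)).comp
      ((h.measurable_state t).prodMk (h.measurable_action t))
  obtain ⟨D, hD⟩ := exists_abs_le_of_finite fun x b => ∫ z, f x b z ∂(M.law x b)
  have hint' : Integrable (fun ω => ∫ z, f (s t ω) (a t ω) z ∂(M.law (s t ω) (a t ω))) μ :=
    Integrable.of_bound (hm.mono (ℱ.le t) le_rfl).aestronglyMeasurable D
      (ae_of_all _ fun ω => hD _ _)
  refine (ae_eq_condExp_of_forall_setIntegral_eq (ℱ.le t) hint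
    (fun _ _ _ => hint'.integrableOn) (fun G hG _ => ?_) hm.aestronglyMeasurable).symm
  -- both integrals split over the values of the current pair
  have hcov : G = ⋃ p : S × A, G ∩ {ω | s t ω = p.1 ∧ a t ω = p.2} := by
    have hU : ⋃ p : S × A, {ω | s t ω = p.1 ∧ a t ω = p.2} = Set.univ :=
      Set.eq_univ_of_forall fun ω => Set.mem_iUnion.2 ⟨(s t ω, a t ω), rfl, rfl⟩
    rw [← Set.inter_iUnion, hU, Set.inter_univ]
  have hGp : ∀ p : S × A, MeasurableSet[ℱ t] (G ∩ {ω | s t ω = p.1 ∧ a t ω = p.2}) := fun p =>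
    hG.inter (h.measurableSet_pair t p.1 p.2)
  have hdisj : Pairwise
      (Function.onFun Disjoint fun p : S × A => G ∩ {ω | s t ω = p.1 ∧ a t ω = p.2}) := by
    intro p p' hpp
    refine Set.disjoint_left.2 fun ω hω hω' => hpp (Prod.ext ?_ ?_)
    · exact hω.2.1.symm.trans hω'.2.1
    · exact hω.2.2.symm.trans hω'.2.2
  rw [hcov, integral_iUnion_fintype (fun p => ℱ.le t _ (hGp p)) hdisj
      fun _ => hint'.integrableOn,
    integral_iUnion_fintype (fun p => ℱ.le t _ (hGp p)) hdisj fun _ => hint.integrableOn]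
  refine Finset.sum_congr rfl fun p _ => ?_
  have hmap := h.map_restrict_eq (hGp p) fun ω hω => hω.2
  rw [setIntegral_congr_fun (ℱ.le t _ (hGp p)) (g := fun _ => ∫ z, f p.1 p.2 z ∂(M.law p.1 p.2))
      (fun ω hω => by simp only [hω.2.1, hω.2.2]), setIntegral_const,
    setIntegral_congr_fun (ℱ.le t _ (hGp p)) (g := fun ω => f p.1 p.2 (r t ω, s' t ω))
      (fun ω hω => by simp only [hω.2.1, hω.2.2]),
    ← integral_map (f := f p.1 p.2) hY.aemeasurable
      (by rw [hmap]; exact (hf p.1 p.2).aestronglyMeasurable.smul_measure _),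
    hmap, integral_smul_measure]
  rfl

/-- Functions of the sampled transition, centered at their conditional expectation and weighted by
predictable weights `w` with `∑ w² < ∞`, have an almost surely convergent sum. -/
theorem ae_exists_tendsto_sum_mul_sub (h : M.IsSampling μ ℱ s a r s') {f : ℝ × S → ℝ}
    (hfm : Measurable f) (hf : ∀ x b, MemLp f 2 (M.law x b)) {w : ℕ → Ω → ℝ}
    (hw : ∀ t, Measurable[ℱ t] (w t)) (hsum : ∀ᵐ ω ∂μ, Summable fun t => w t ω ^ 2) :
    ∀ᵐ ω ∂μ, ∃ l, Tendsto (fun n => ∑ t ∈ Finset.range n,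
      w t ω * (f (r t ω, s' t ω) - ∫ z, f z ∂(M.law (s t ω) (a t ω)))) atTop (𝓝 l) := by
  set m : S → A → ℝ := fun x b => ∫ z, f z ∂(M.law x b) with hmdef
  have hc2 : ∀ x b, MemLp (fun z => f z - m x b) 2 (M.law x b) := fun x b =>
    have := M.isProbabilityMeasure_law x b
    (hf x b).sub (memLp_const _)
  have hc1 : ∀ x b, Integrable (fun z => f z - m x b) (M.law x b) := fun x b =>
    have := M.isProbabilityMeasure_law x b
    (hc2 x b).integrable one_le_two
  obtain ⟨C, hC⟩ := exists_abs_le_of_finite fun x b => ∫ z, (f z - m x b) ^ 2 ∂(M.law x b)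
  have hξm : ∀ t, Measurable[ℱ (t + 1)] fun ω => f (r t ω, s' t ω) - m (s t ω) (a t ω) :=
    fun t => (hfm.comp (h.measurable_sample t)).sub
      (((measurable_of_countable fun p : S × A => m p.1 p.2).comp
        ((h.measurable_state t).prodMk (h.measurable_action t))).mono (ℱ.mono t.le_succ) le_rfl)
  refine ae_exists_tendsto_sum_mul (C := max C 0) (le_max_right _ _) hw hξm (fun t => ?_)
    (fun t => ?_) (fun t => ?_) hsum
  · exact (memLp_two_iff_integrable_sq
      ((hξm t).mono (ℱ.le _) le_rfl).aestronglyMeasurable).2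
      (h.integrable_sample (f := fun x b z => (f z - m x b) ^ 2)
        (fun x b => (hc2 x b).integrable_sq) t)
  · filter_upwards [h.condExp_sample (f := fun x b z => f z - m x b) hc1 t] with ω hω
    have := M.isProbabilityMeasure_law (s t ω) (a t ω)
    rw [hω, integral_sub ((hf _ _).integrable one_le_two) (integrable_const _)]
    simp [hmdef]
  · filter_upwards [h.condExp_sample (f := fun x b z => (f z - m x b) ^ 2)
      (fun x b => (hc2 x b).integrable_sq) t] with ω hω
    rw [hω]
    exact (le_abs_self _).trans ((hC _ _).trans (le_max_left _ _))

end MDP.IsSampling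

/-! ### The learning rule along a single sample path -/

section Path

variable {S A : Type*} {γ : ℝ} {s : ℕ → S} {a : ℕ → A} {r : ℕ → ℝ} {s' : ℕ → S}
  {a' : ℕ → A} {α : ℕ → S → A → ℝ} {Q Q' : ℕ → S → A → ℝ}

theorem effectiveRate_nonneg (hα : ∀ t, 0 < α t (s t) (a t) ∧ α t (s t) (a t) < 1)
    (x : S) (b : A) (t : ℕ) : 0 ≤ effectiveRate s a α x b t := by
  unfold effectiveRate
  split_ifs with h
  · rw [← h.1, ← h.2]; exact (hα t).1.le
  · exact le_rfl

theorem effectiveRate_le_one (hα : ∀ t, 0 < α t (s t) (a t) ∧ α t (s t) (a t) < 1)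
    (x : S) (b : A) (t : ℕ) : effectiveRate s a α x b t ≤ 1 := by
  unfold effectiveRate
  split_ifs with h
  · rw [← h.1, ← h.2]; exact (hα t).2.le
  · exact zero_le_one

theorem eq_of_effectiveRate_ne_zero {x : S} {b : A} {t : ℕ}
    (h : effectiveRate s a α x b t ≠ 0) : s t = x ∧ a t = b := by
  by_contra h'
  exact h (if_neg h')

theorem tableUpdate_eq_effectiveRate (q : S → A → ℝ) (t : ℕ) (y : ℝ) (x : S) (b : A) :
    tableUpdate q (s t) (a t) (α t (s t) (a t)) y x b
      = (1 - effectiveRate s a α x b t) * q x b + effectiveRate s a α x b t * y := by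
  unfold tableUpdate effectiveRate
  by_cases h : s t = x ∧ a t = b
  · obtain ⟨rfl, rfl⟩ := h
    simp
  · rw [if_neg h, if_neg fun h' => h ⟨h'.1.symm, h'.2.symm⟩]
    ring

theorem abs_convexCombination_le {β z y Y : ℝ} (h0 : 0 ≤ β) (h1 : β ≤ 1)
    (hy : β ≠ 0 → |y| ≤ Y) : |(1 - β) * z + β * y| ≤ (1 - β) * |z| + β * Y := by
  have hβ : β * |y| ≤ β * Y := by
    rcases eq_or_ne β 0 with h | h
    · simp [h]
    · exact mul_le_mul_of_nonneg_left (hy h) h0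
  calc |(1 - β) * z + β * y| ≤ |(1 - β) * z| + |β * y| := abs_add_le _ _
    _ = (1 - β) * |z| + β * |y| := by
      rw [abs_mul, abs_mul, abs_of_nonneg h0, abs_of_nonneg (sub_nonneg.2 h1)]
    _ ≤ _ := by linarith

namespace IsMomentumDoubleQ

/-- Since both tables are moved towards the same target, their difference at every entry is
multiplied by `1 - β` at each step, and so vanishes in the limit. -/
theorem tendsto_sub_zero (h : IsMomentumDoubleQ γ s a r s' a' α Q Q')
    (hα : ∀ t, 0 < α t (s t) (a t) ∧ α t (s t) (a t) < 1)
    (hsum : ∀ x b, Tendsto (fun n => ∑ t ∈ Finset.range n, effectiveRate s a α x b t) atTop atTop)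
    (x : S) (b : A) : Tendsto (fun t => Q t x b - Q' t x b) atTop (𝓝 0) := by
  refine tendsto_zero_of_averaging (c := fun _ => 0) (effectiveRate_nonneg hα x b)
    (effectiveRate_le_one hα x b) (hsum x b) tendsto_const_nhds fun t => ?_
  rw [h.update_fst, h.update_snd, tableUpdate_eq_effectiveRate, tableUpdate_eq_effectiveRate]
  ring

variable [Fintype S] [Fintype A]

/-- The momentum target differs from the target of ordinary `Q`-learning by a vanishing
amount. -/
theorem exists_tendsto_zero_abs_target_sub_le (hγ0 : 0 ≤ γ) (hγ1 : γ < 1)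
    (h : IsMomentumDoubleQ γ s a r s' a' α Q Q')
    (hα : ∀ t, 0 < α t (s t) (a t) ∧ α t (s t) (a t) < 1)
    (hsum : ∀ x b, Tendsto (fun n => ∑ t ∈ Finset.range n, effectiveRate s a α x b t)
      atTop atTop) :
    ∃ c : ℕ → ℝ, Tendsto c atTop (𝓝 0) ∧ ∀ t,
      |momentumTarget γ (r t) (Q t) (Q' t) (s' t) (a' t) (lastGap Q Q' s' a' t)
        - (r t + γ * greedyValue (Q t) (s' t))| ≤ c t := by
  -- a bound for all gaps at time `t`
  set G : ℕ → ℝ := fun t => ∑ x, ∑ b, |Q t x b - Q' t x b| with hG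
  have hG0 : Tendsto G atTop (𝓝 0) := by
    have : Tendsto G atTop (𝓝 (∑ _x : S, ∑ _b : A, |(0 : ℝ)|)) :=
      tendsto_finsetSum _ fun x _ => tendsto_finsetSum _ fun b _ =>
        (h.tendsto_sub_zero hα hsum x b).abs
    simpa using this
  have hgap : ∀ t x b, tableGap (Q t) (Q' t) x b ≤ G t := fun t x b =>
    (Finset.single_le_sum (f := fun b => |Q t x b - Q' t x b|) (fun _ _ => abs_nonneg _)
      (Finset.mem_univ b)).trans
      (Finset.single_le_sum (f := fun x => ∑ b, |Q t x b - Q' t x b|)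
        (fun _ _ => Finset.sum_nonneg fun _ _ => abs_nonneg _) (Finset.mem_univ x))
  have hlast0 : ∀ t, 0 ≤ lastGap Q Q' s' a' t := fun t => by
    cases t with
    | zero => exact le_rfl
    | succ t => exact abs_nonneg _
  have hlast : Tendsto (lastGap Q Q' s' a') atTop (𝓝 0) := by
    rw [← tendsto_add_atTop_iff_nat 1]
    exact squeeze_zero (fun t => hlast0 _) (fun t => hgap t (s' t) (a' t)) hG0
  refine ⟨fun t => G t + lastGap Q Q' s' a' t, by simpa using hG0.add hlast, fun t => ?_⟩
  rw [greedyValue_eq_of_forall_le (h.greedy t)]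
  have h1 := hgap t (s' t) (a' t)
  have h2 := hlast0 t
  unfold momentumTarget
  unfold tableGap at h1 ⊢
  set u := Q t (s' t) (a' t)
  set u' := Q' t (s' t) (a' t)
  set l := lastGap Q Q' s' a' t
  have h3 : |max u u' - (|u - u'| + l) / 2 - u| ≤ G t + l := by
    rcases max_cases u u' with ⟨h4, h5⟩ | ⟨h4, h5⟩
    · rw [abs_of_nonneg (sub_nonneg.2 h5)] at h1 ⊢
      rw [h4, abs_le]; constructor <;> linarith
    · rw [abs_of_neg (sub_neg.2 h5)] at h1 ⊢
      rw [h4, abs_le]; constructor <;> linarith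
  calc |r t + γ * (max u u' - (|u - u'| + l) / 2) - (r t + γ * u)|
      = γ * |max u u' - (|u - u'| + l) / 2 - u| := by
        rw [← abs_of_nonneg hγ0, ← abs_mul, abs_of_nonneg hγ0]; congr 1; ring
    _ ≤ 1 * |max u u' - (|u - u'| + l) / 2 - u| :=
        mul_le_mul_of_nonneg_right hγ1.le (abs_nonneg _)
    _ ≤ G t + l := by rw [one_mul]; exact h3

variable [MeasurableSpace S] [Nonempty A]

/-- The tables stay bounded once the reward noise is averaged out: apart from the reward, the
target is at most `γ` times the current sup norm, up to a bounded term. -/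
theorem exists_abs_le (M : MDP S A) (hγ0 : 0 ≤ γ) (hγ1 : γ < 1)
    (h : IsMomentumDoubleQ γ s a r s' a' α Q Q')
    (hα : ∀ t, 0 < α t (s t) (a t) ∧ α t (s t) (a t) < 1)
    (hsum : ∀ x b, Tendsto (fun n => ∑ t ∈ Finset.range n, effectiveRate s a α x b t) atTop atTop)
    (hnoise : ∀ x b, ∃ l, Tendsto (fun n => ∑ t ∈ Finset.range n,
      effectiveRate s a α x b t * (r t - M.meanReward (s t) (a t))) atTop (𝓝 l)) :
    ∃ B, ∀ t x b, |Q t x b| ≤ B := by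
  obtain ⟨c, hc0, hc⟩ := h.exists_tendsto_zero_abs_target_sub_le hγ0 hγ1 hα hsum
  obtain ⟨C, hC⟩ := hc0.bddAbove_range
  obtain ⟨R, hR⟩ := exists_abs_le_of_finite M.meanReward
  set W : S × A → ℕ → ℝ := fun p => runningAverage (effectiveRate s a α p.1 p.2)
    (fun t => r t - M.meanReward (s t) (a t)) with hW
  have hWb : ∃ w, ∀ p t, |W p t| ≤ w := by
    have : ∀ p, ∃ w, ∀ t, |W p t| ≤ w := fun p => by
      obtain ⟨l, hl⟩ := hnoise p.1 p.2
      obtain ⟨w, hw⟩ := (tendsto_runningAverage_zero (effectiveRate_nonneg hα p.1 p.2)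
        (effectiveRate_le_one hα p.1 p.2) (hsum p.1 p.2) hl).abs.bddAbove_range
      exact ⟨w, fun t => hw ⟨t, rfl⟩⟩
    choose w hw using this
    obtain ⟨w', hw'⟩ := (Set.finite_range w).bddAbove
    exact ⟨w', fun p t => (hw p t).trans (hw' ⟨p, rfl⟩)⟩
  obtain ⟨w, hw⟩ := hWb
  have hZ := bounded_of_async_contraction (γ := γ)
    (Z := fun t (p : S × A) => Q t p.1 p.2 - W p t)
    (β := fun t p => effectiveRate s a α p.1 p.2 t) (c := fun t => c t + γ * w + R)
    (C := C + γ * w + R) hγ1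
    (fun t p => effectiveRate_nonneg hα p.1 p.2 t) (fun t p => effectiveRate_le_one hα p.1 p.2 t)
    (fun t D hD p => ?_) (fun t => by linarith [hC ⟨t, rfl⟩])
  · obtain ⟨B, hB⟩ := hZ
    refine ⟨B + w, fun t x b => ?_⟩
    have h1 := hB t (x, b)
    have h2 := hw (x, b) t
    calc |Q t x b| = |(Q t x b - W (x, b) t) + W (x, b) t| := by rw [sub_add_cancel]
      _ ≤ B + w := (abs_add_le _ _).trans (add_le_add h1 h2)
  · have hV : |greedyValue (Q t) (s' t)| ≤ D + w := abs_greedyValue_le fun b =>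
      calc |Q t (s' t) b| = |(Q t (s' t) b - W (s' t, b) t) + W (s' t, b) t| := by
            rw [sub_add_cancel]
        _ ≤ D + w := (abs_add_le _ _).trans (add_le_add (hD (s' t, b)) (hw _ t))
    have hstep : Q (t + 1) p.1 p.2 - W p (t + 1)
        = (1 - effectiveRate s a α p.1 p.2 t) * (Q t p.1 p.2 - W p t)
          + effectiveRate s a α p.1 p.2 t *
            (momentumTarget γ (r t) (Q t) (Q' t) (s' t) (a' t) (lastGap Q Q' s' a' t)
              - r t + M.meanReward (s t) (a t)) := by
      rw [h.update_fst, tableUpdate_eq_effectiveRate]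
      simp only [hW, runningAverage]
      ring
    rw [hstep]
    refine abs_convexCombination_le (effectiveRate_nonneg hα _ _ t)
      (effectiveRate_le_one hα _ _ t) fun _ => ?_
    have h1 := abs_le.1 (hc t)
    have h2 := abs_le.1 (hR (s t) (a t))
    have h3 : |γ * greedyValue (Q t) (s' t)| ≤ γ * (D + w) := by
      rw [abs_mul, abs_of_nonneg hγ0]
      exact mul_le_mul_of_nonneg_left hV hγ0
    have h4 := abs_le.1 h3
    rw [abs_le]
    constructor <;> linarith

variable [MeasurableSingletonClass S]

/-- If the noise of the ordinary `Q`-learning target averages out, then the table converges to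
the fixed point of the Bellman operator. -/
theorem tendsto_of_bellman_eq (M : MDP S A) (hγ0 : 0 ≤ γ) (hγ1 : γ < 1)
    (h : IsMomentumDoubleQ γ s a r s' a' α Q Q')
    (hα : ∀ t, 0 < α t (s t) (a t) ∧ α t (s t) (a t) < 1)
    (hsum : ∀ x b, Tendsto (fun n => ∑ t ∈ Finset.range n, effectiveRate s a α x b t) atTop atTop)
    (hnoise : ∀ x b, ∃ l, Tendsto (fun n => ∑ t ∈ Finset.range n,
      effectiveRate s a α x b t *
        (r t + γ * greedyValue (Q t) (s' t) - M.bellman γ (Q t) (s t) (a t))) atTop (𝓝 l))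
    {q : S → A → ℝ} (hq : M.bellman γ q = q) (x : S) (b : A) :
    Tendsto (fun t => Q t x b) atTop (𝓝 (q x b)) := by
  obtain ⟨c, hc0, hc⟩ := h.exists_tendsto_zero_abs_target_sub_le hγ0 hγ1 hα hsum
  set W : S × A → ℕ → ℝ := fun p => runningAverage (effectiveRate s a α p.1 p.2)
    (fun t => r t + γ * greedyValue (Q t) (s' t) - M.bellman γ (Q t) (s t) (a t)) with hW
  have hW0 : ∀ p, Tendsto (W p) atTop (𝓝 0) := fun p => by
    obtain ⟨l, hl⟩ := hnoise p.1 p.2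
    exact tendsto_runningAverage_zero (effectiveRate_nonneg hα p.1 p.2)
      (effectiveRate_le_one hα p.1 p.2) (hsum p.1 p.2) hl
  have hw0 : Tendsto (fun t => ∑ p, |W p t|) atTop (𝓝 0) := by
    simpa using tendsto_finsetSum Finset.univ fun p _ => (hW0 p).abs
  have hw : ∀ p t, |W p t| ≤ ∑ p, |W p t| := fun p t =>
    Finset.single_le_sum (f := fun p => |W p t|) (fun _ _ => abs_nonneg _) (Finset.mem_univ p)
  have hZ := tendsto_zero_of_async_contraction (γ := γ)
    (Z := fun t (p : S × A) => Q t p.1 p.2 - W p t - q p.1 p.2)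
    (β := fun t p => effectiveRate s a α p.1 p.2 t) (c := fun t => c t + γ * ∑ p, |W p t|)
    hγ0 hγ1 (fun t p => effectiveRate_nonneg hα p.1 p.2 t)
    (fun t p => effectiveRate_le_one hα p.1 p.2 t) (fun p => hsum p.1 p.2)
    (fun t D hD p => ?_) (by simpa using hc0.add (hw0.const_mul γ)) (x, b)
  · simpa using ((hZ.add (hW0 (x, b))).add_const (q x b)).congr
      (f₂ := fun t => Q t x b) fun t => by ring
  · have hstep : Q (t + 1) p.1 p.2 - W p (t + 1) - q p.1 p.2
        = (1 - effectiveRate s a α p.1 p.2 t) * (Q t p.1 p.2 - W p t - q p.1 p.2)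
          + effectiveRate s a α p.1 p.2 t *
            ((momentumTarget γ (r t) (Q t) (Q' t) (s' t) (a' t) (lastGap Q Q' s' a' t)
              - (r t + γ * greedyValue (Q t) (s' t)))
              + (M.bellman γ (Q t) (s t) (a t) - q p.1 p.2)) := by
      rw [h.update_fst, tableUpdate_eq_effectiveRate]
      simp only [hW, runningAverage]
      ring
    rw [hstep]
    refine abs_convexCombination_le (effectiveRate_nonneg hα _ _ t)
      (effectiveRate_le_one hα _ _ t) fun hne => ?_
    -- the entry is the sampled pair, so its target is the Bellman image at that pair
    obtain ⟨h1, h2⟩ := eq_of_effectiveRate_ne_zero hne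
    have h3 : |M.bellman γ (Q t) (s t) (a t) - q p.1 p.2| ≤ γ * (D + ∑ p, |W p t|) := by
      have hfix : q p.1 p.2 = M.bellman γ q (s t) (a t) := by rw [hq, h1, h2]
      rw [hfix]
      refine M.abs_bellman_sub_le hγ0 (fun y d => ?_) _ _
      calc |Q t y d - q y d| = |(Q t y d - W (y, d) t - q y d) + W (y, d) t| := by
            congr 1; ring
        _ ≤ _ := (abs_add_le _ _).trans (add_le_add (hD (y, d)) (hw _ t))
    refine (abs_add_le _ _).trans ((add_le_add (hc t) h3).trans_eq ?_)
    ring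

end IsMomentumDoubleQ

end Path

/-! ### Measurability of the tables and almost sure convergence -/

section AlmostSure

variable {S A : Type*} [MeasurableSpace S] [MeasurableSingletonClass S]
  [MeasurableSpace A] [MeasurableSingletonClass A]
  {M : MDP S A} {γ : ℝ} {Ω : Type*} [mΩ : MeasurableSpace Ω] {μ : Measure Ω}
  {ℱ : Filtration ℕ mΩ} {s : ℕ → Ω → S} {a : ℕ → Ω → A} {r : ℕ → Ω → ℝ} {s' : ℕ → Ω → S}
  {a' : ℕ → Ω → A} {α : ℕ → Ω → S → A → ℝ} {Q Q' : ℕ → Ω → S → A → ℝ}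

theorem measurable_effectiveRate (hsample : M.IsSampling μ ℱ s a r s')
    (hα : ∀ t x b, Measurable[ℱ t] (fun ω => α t ω x b)) (x : S) (b : A) (t : ℕ) :
    Measurable[ℱ t] fun ω =>
      effectiveRate (fun t => s t ω) (fun t => a t ω) (fun t => α t ω) x b t := by
  classical
  unfold effectiveRate
  refine Measurable.ite ?_ (hα t x b) measurable_const
  exact hsample.measurableSet_pair t x b

theorem measurable_tables [Countable S] [Countable A] (hsample : M.IsSampling μ ℱ s a r s')
    (ha' : ∀ t, Measurable[ℱ (t + 1)] (a' t))
    (hα : ∀ t x b, Measurable[ℱ t] (fun ω => α t ω x b))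
    (hQ0 : ∀ x b, Measurable[ℱ 0] (fun ω => Q 0 ω x b))
    (hQ'0 : ∀ x b, Measurable[ℱ 0] (fun ω => Q' 0 ω x b))
    (hrule : ∀ ω, IsMomentumDoubleQ γ (fun t => s t ω) (fun t => a t ω) (fun t => r t ω)
      (fun t => s' t ω) (fun t => a' t ω) (fun t => α t ω) (fun t => Q t ω) (fun t => Q' t ω))
    (t : ℕ) :
    (∀ x b, Measurable[ℱ t] fun ω => Q t ω x b) ∧ (∀ x b, Measurable[ℱ t] fun ω => Q' t ω x b) ∧
      Measurable[ℱ t] fun ω =>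
        lastGap (fun t => Q t ω) (fun t => Q' t ω) (fun t => s' t ω) (fun t => a' t ω) t := by
  induction t with
  | zero => exact ⟨hQ0, hQ'0, measurable_const⟩
  | succ t ih =>
    obtain ⟨hQ, hQ', hlast⟩ := ih
    have hle : ℱ t ≤ ℱ (t + 1) := ℱ.mono t.le_succ
    have heval : ∀ {P : Ω → S → A → ℝ}, (∀ x b, Measurable[ℱ t] fun ω => P ω x b) →
        Measurable[ℱ (t + 1)] fun ω => P ω (s' t ω) (a' t ω) := fun hP =>
      Measurable.eval_of_countable (X := S × A) (f := fun p ω => _)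
        (fun p => (hP p.1 p.2).mono hle le_rfl) ((hsample.measurable_next t).prodMk (ha' t))
    have hgap : Measurable[ℱ (t + 1)] fun ω =>
        tableGap (Q t ω) (Q' t ω) (s' t ω) (a' t ω) :=
      continuous_abs.measurable.comp ((heval hQ).sub (heval hQ'))
    have htarget : Measurable[ℱ (t + 1)] fun ω => momentumTarget γ (r t ω) (Q t ω) (Q' t ω)
        (s' t ω) (a' t ω)
        (lastGap (fun t => Q t ω) (fun t => Q' t ω) (fun t => s' t ω) (fun t => a' t ω) t) :=
      (hsample.measurable_reward t).add ((((heval hQ).max (heval hQ')).sub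
        ((hgap.add (hlast.mono hle le_rfl)).div_const 2)).const_mul γ)
    have hβ := fun x b => (measurable_effectiveRate hsample hα x b t).mono hle le_rfl
    have hupdate : ∀ {P : Ω → S → A → ℝ}, (∀ x b, Measurable[ℱ t] fun ω => P ω x b) → ∀ x b,
        Measurable[ℱ (t + 1)] fun ω => tableUpdate (P ω) (s t ω) (a t ω)
          (α t ω (s t ω) (a t ω)) (momentumTarget γ (r t ω) (Q t ω) (Q' t ω) (s' t ω) (a' t ω)
            (lastGap (fun t => Q t ω) (fun t => Q' t ω) (fun t => s' t ω) (fun t => a' t ω) t))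
          x b := by
      intro P hP x b
      have heq := fun ω => tableUpdate_eq_effectiveRate (s := fun t => s t ω)
        (a := fun t => a t ω) (α := fun t => α t ω) (P ω) t (momentumTarget γ (r t ω) (Q t ω)
          (Q' t ω) (s' t ω) (a' t ω) (lastGap (fun t => Q t ω) (fun t => Q' t ω)
            (fun t => s' t ω) (fun t => a' t ω) t)) x b
      simp only [heq]
      exact (((measurable_const.sub (hβ x b)).mul ((hP x b).mono hle le_rfl))).add
        ((hβ x b).mul htarget)
    refine ⟨fun x b => ?_, fun x b => ?_, hgap⟩
    · simpa only [(hrule _).update_fst t] using hupdate hQ x b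
    · simpa only [(hrule _).update_snd t] using hupdate hQ' x b

end AlmostSure

theorem mainTheorem1
    {S A : Type*} [Fintype S] [MeasurableSpace S] [MeasurableSingletonClass S]
    [Fintype A] [MeasurableSpace A] [MeasurableSingletonClass A]
    (M : MDP S A) (γ : ℝ) (hγ0 : 0 ≤ γ) (hγ1 : γ < 1)
    {Ω : Type*} [mΩ : MeasurableSpace Ω] (μ : Measure Ω) [IsProbabilityMeasure μ]
    (ℱ : Filtration ℕ mΩ)
    -- the sampled transitions, the greedy next actions, the learning rates and the two tables
    (s : ℕ → Ω → S) (a : ℕ → Ω → A) (r : ℕ → Ω → ℝ) (s' : ℕ → Ω → S) (a' : ℕ → Ω → A)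
    (α : ℕ → Ω → S → A → ℝ) (Q Q' : ℕ → Ω → S → A → ℝ)
    (hsample : M.IsSampling μ ℱ s a r s')
    (ha' : ∀ t, Measurable[ℱ (t + 1)] (a' t))
    (hα : ∀ t x b, Measurable[ℱ t] (fun ω => α t ω x b))
    (hQ0 : ∀ x b, Measurable[ℱ 0] (fun ω => Q 0 ω x b))
    (hQ'0 : ∀ x b, Measurable[ℱ 0] (fun ω => Q' 0 ω x b))
    (hrule : ∀ ω, IsMomentumDoubleQ γ (fun t => s t ω) (fun t => a t ω) (fun t => r t ω)
      (fun t => s' t ω) (fun t => a' t ω) (fun t => α t ω) (fun t => Q t ω) (fun t => Q' t ω))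
    -- every state-action pair is sampled, and hence both tables are updated there,
    -- infinitely often
    (hinf : ∀ᵐ ω ∂μ, ∀ x b, ∃ᶠ t in atTop, s t ω = x ∧ a t ω = b)
    -- the learning rates
    (hα01 : ∀ᵐ ω ∂μ, ∀ t, 0 < α t ω (s t ω) (a t ω) ∧ α t ω (s t ω) (a t ω) < 1)
    (hαsum : ∀ᵐ ω ∂μ, ∀ x b, Tendsto (fun n => ∑ t ∈ Finset.range n,
      effectiveRate (fun t => s t ω) (fun t => a t ω) (fun t => α t ω) x b t) atTop atTop)
    (hαsq : ∀ᵐ ω ∂μ, ∀ x b, Summable (fun t =>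
      effectiveRate (fun t => s t ω) (fun t => a t ω) (fun t => α t ω) x b t ^ 2))
    -- the rewards have finite variance
    (hvar : ∀ x b, M.rewardVariance x b < ⊤) :
    ∀ᵐ ω ∂μ, ∀ x b,
      Tendsto (fun t => Q t ω x b) atTop (𝓝 (M.qStar γ x b)) ∧
      Tendsto (fun t => Q' t ω x b) atTop (𝓝 (M.qStar γ x b)) := by
  obtain ⟨ω₀⟩ := μ.nonempty_of_neZero
  have : Nonempty A := ⟨a 0 ω₀⟩
  set β : S → A → ℕ → Ω → ℝ := fun x b t ω =>
    effectiveRate (fun t => s t ω) (fun t => a t ω) (fun t => α t ω) x b t with hβ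
  have hβm : ∀ x b t, Measurable[ℱ t] (β x b t) := measurable_effectiveRate hsample hα
  have hQm := fun t => (measurable_tables hsample ha' hα hQ0 hQ'0 hrule t).1
  have hVm : ∀ t y, Measurable[ℱ t] fun ω => greedyValue (Q t ω) y := fun t y =>
    Measurable.iSup fun b => hQm t y b
  -- the reward noise averages out, hence the tables are bounded along almost every path
  have hreward : ∀ᵐ ω ∂μ, ∀ x b, ∃ l, Tendsto (fun n => ∑ t ∈ Finset.range n,
      β x b t ω * (r t ω - M.meanReward (s t ω) (a t ω))) atTop (𝓝 l) := by
    refine ae_all_iff.2 fun x => ae_all_iff.2 fun b => ?_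
    refine hsample.ae_exists_tendsto_sum_mul_sub measurable_fst (fun y c => ?_) (hβm x b)
      (hαsq.mono fun ω h => h x b)
    have := M.isProbabilityMeasure_law y c
    exact (evariance_lt_top_iff_memLp measurable_fst.aestronglyMeasurable).1 (hvar y c)
  have hbdd : ∀ᵐ ω ∂μ, ∃ B, ∀ t x b, |Q t ω x b| ≤ B := by
    filter_upwards [hreward, hα01, hαsum] with ω h1 h2 h3
    exact (hrule ω).exists_abs_le M hγ0 hγ1 h2 h3 h1
  -- by boundedness the transition noise, weighted by the current values, averages out too
  have htrans : ∀ᵐ ω ∂μ, ∀ x b y, ∃ l, Tendsto (fun n => ∑ t ∈ Finset.range n,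
      (β x b t ω * greedyValue (Q t ω) y) *
        ((Prod.snd ⁻¹' {y}).indicator 1 (r t ω, s' t ω) - M.trans (s t ω) (a t ω) y))
      atTop (𝓝 l) := by
    refine ae_all_iff.2 fun x => ae_all_iff.2 fun b => ae_all_iff.2 fun y => ?_
    have hset : MeasurableSet (Prod.snd ⁻¹' {y} : Set (ℝ × S)) :=
      measurable_snd (measurableSet_singleton y)
    have hind : ∀ z c, ∫ p, (Prod.snd ⁻¹' {y}).indicator (1 : ℝ × S → ℝ) p ∂(M.law z c)
        = M.trans z c y := fun z c => integral_indicator_one hset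
    simp only [← hind]
    refine hsample.ae_exists_tendsto_sum_mul_sub (measurable_one.indicator hset) (fun z c => ?_)
      (fun t => (hβm x b t).mul (hVm t y)) ?_
    · have := M.isProbabilityMeasure_law z c
      exact (memLp_const (1 : ℝ)).indicator hset
    · filter_upwards [hbdd, hαsq] with ω ⟨B, hB⟩ h
      refine Summable.of_nonneg_of_le (fun _ => sq_nonneg _) (fun t => ?_)
        ((h x b).mul_right (B ^ 2))
      rw [mul_pow]
      exact mul_le_mul_of_nonneg_left
        (sq_le_sq' (abs_le.1 (abs_greedyValue_le (hB t y))).1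
          (abs_le.1 (abs_greedyValue_le (hB t y))).2) (sq_nonneg _)
  filter_upwards [hreward, htrans, hα01, hαsum] with ω h1 h2 h3 h4
  have hQ : ∀ x b, Tendsto (fun t => Q t ω x b) atTop (𝓝 (M.qStar γ x b)) := by
    refine (hrule ω).tendsto_of_bellman_eq M hγ0 hγ1 h3 h4 (fun x b => ?_)
      (M.bellman_qStar hγ0 hγ1)
    obtain ⟨l, hl⟩ := h1 x b
    choose m hm using h2 x b
    refine ⟨l + γ * ∑ y, m y, ?_⟩
    refine (hl.add ((tendsto_finsetSum Finset.univ fun y _ => hm y).const_mul γ)).congr fun n => ?_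
    rw [Finset.sum_comm, Finset.mul_sum, ← Finset.sum_add_distrib]
    refine Finset.sum_congr rfl fun t _ => ?_
    have hsplit : ∑ y, (β x b t ω * greedyValue (Q t ω) y) *
        ((Prod.snd ⁻¹' {y}).indicator 1 (r t ω, s' t ω) - M.trans (s t ω) (a t ω) y)
        = β x b t ω * (greedyValue (Q t ω) (s' t ω)
          - ∑ y, M.trans (s t ω) (a t ω) y * greedyValue (Q t ω) y) := by
      classical
      simp only [mul_assoc, ← Finset.mul_sum, mul_sub, Finset.sum_sub_distrib]
      congr 2
      · simp [Set.indicator_apply]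
      · exact Finset.sum_congr rfl fun y _ => mul_comm _ _
    rw [hsplit, MDP.bellman]
    ring
  intro x b
  refine ⟨hQ x b, ?_⟩
  simpa using (hQ x b).sub ((hrule ω).tendsto_sub_zero h3 h4 x b)
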